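/- Let $S$ be a finite set and $\mu:S\times S\to\mathbb{R}_+$ a directed distance (i.e. $\mu(s,s)=0$ for all $s$). \emph{Notation.} Let $S^c,S^r$ be disjoint copies of $S$, $S^{cr}=S^c\cup S^r$, and write $s^c,s^r$ for the copies of $s\in S$. Let $P_\mu=\{p\in\mathbb{R}^{S^{cr}} \mid p(s^c)+p(t^r)\ge\mu(s,t)\ (s,t\in S)\}$ and let $Q_\mu$ be the set of minimal elements of $P_\mu$. For a set $R\subseteq \mathbb{R}^{S^{cr}}$, $R^+$ is the set of its nonnegative points, and $R_s$ is the set of $p\in R$ with $p(s^c)+p(s^r)=0$. Let $\mu_s$ be the point with $\mu_s(t^c)=\mu(t,s)$, $\mu_s(t^r)=\mu(s,t)$. For $p\in P_\mu$ let $K(p)$ be the bipartite graph on $S^{cr}$ with edges $s^ct^r$ for $p(s^c)+p(t^r)=\mu(s,t)$, and let $N_p(U)$ be the set of nodes outside $U$ joined to $U$ in $K(p)$. Let $\mathcal{S}_0$ be the family of $X\subseteq S$ with $\mu=0$ on $X\times X$; for $X\in\mathcal{S}_0$ let $Q_{\mu,X}$ be the set of $p\in Q_\mu$ such that $s^cs^r$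 is an edge of $K(p)$ exactly when $s\in X$. A point $p\in Q_{\mu,X}$ is a \emph{fat} (relative to $X$) if $N_p(S^c\setminus X^c)\subseteq S^r\setminus X^r$ or $N_p(S^r\setminus X^r)\subseteq S^c\setminus X^c$; $Q_{\mu,X}^{deg}$ is the set of $p\in Q_{\mu,X}$ for which one of these inclusions is an equality. A fat in no $Q_{\mu,X}^{deg}$ is \emph{proper}, and $Q_\mu^{slim}$ is $Q_\mu$ without the proper fats. On $Q_\mu^{slim}$ let $p\sim q$ if $p-q\in(\mathbf 1,-\mathbf 1)\mathbb{R}$, or if for some $X\in\mathcal{S}_0$ both $p,q\in Q_{\mu,X}^{deg}$ and $p-q\in(\mathbf 1,-\mathbf 1)\mathbb{R}+(\mathbf 1_{X^c},-\mathbf 1_{X^r})\mathbb{R}$. A \emph{slimmed section} in $(Q_\mu^{slim})^+$ is a subset $R$ of $(Q_\mu^{slim})^+$ that maps bijectively onto $Q_\mu^{slim}/\!\sim$, that is balanced (no $p,q\in R$ have $p(s^c)<q(s^c)$ for all $s\in S$, or $p(s^r)<q(s^r)$ for all $s\in S$), and such that for no $X\in\mathcal{S}_0$ are there distinct $p,q\in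 R\cap(Q_{\mu,X}^{deg})^+$ with $p(s^c)<q(s^c)$ for all $s\in S\setminus X$, or $p(s^r)<q(s^r)$ for all $s\in S\setminus X$. An \emph{oriented tree} $\Gamma$ is a directed graph whose underlying undirected graph is a tree; a subtree is a subgraph whose underlying graph is a tree. For edge lengths $\alpha:E\Gamma\to\mathbb{R}_+$, $D_{\Gamma,\alpha}(u,v)$ is the sum of $\alpha(e)$ over the edges $e$ traversed in their forward direction by the path of $\Gamma$ from $u$ to $v$, and $D_{\Gamma,\alpha}(A,B)$ is its minimum over pairs in $A\times B$. An \emph{oriented-tree realization} of $\mu$ is a triple $(\Gamma,\alpha;\{F_s\}_{s\in S})$ of an oriented tree, nonnegative edge lengths and subtrees $F_s$ with $\mu(s,t)=D_{\Gamma,\alpha}(F_s,F_t)$ for all $s,t\in S$. \textbf{Proposition.} Suppose that $\mu$ has an oriented-tree realization $(\Gamma,\alpha;\{F_s\}_{s\in S})$ such that $\{F_s\}_{s\in S}$ contains all single-node subtrees of $\Gamma$. Let $S_0\subseteq S$ be the set of $s$ such that $F_s$ is a single node $v_s$. Then: \begin{enumerate} \item[(1)] $(Q_\mu^{slim})^+=\{\mu_s\mid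 s\in S_0\}\cup\bigcup\{[\mu_s,\mu_t]\mid s,t\in S_0,\ v_sv_t\in E\Gamma\}$. \item[(2)] $(Q_\mu^{slim})^+_s=\{\mu_t\mid t\in S_0,\ v_t\in VF_s\}\cup\bigcup\{[\mu_t,\mu_u]\mid t,u\in S_0,\ v_tv_u\in EF_s\}$ for every $s\in S$. \item[(3)] $(Q_\mu^{slim})^+$ itself is a slimmed section. \item[(4)] If $\mu\ne 0$, then for every $s\in S$ such that $F_s$ is a single node or a directed path, $(Q_\mu)_s$ contains no fat. \end{enumerate} (The one-point sets in (1) and (2) are redundant as soon as $\Gamma$, respectively $F_s$, has an edge.) -/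

import Mathlib

noncomputable section

namespace DirectedMultiflow

/-! ### Directed distances and the polyhedra `P_μ`, `Q_μ` -/

/-- A directed distance on `S`: a nonnegative function on `S × S` with zero diagonal. -/
structure IsDirectedDistance {S : Type*} (μ : S → S → ℝ) : Prop where
  nonneg : ∀ s t, 0 ≤ μ s t
  diag : ∀ s, μ s s = 0

/-- The space `ℝ^{S^{cr}}`, where `S^{cr}` is the disjoint union of two copies of `S`: the
coordinate `s^c` is `Sum.inl s`, and `s^r` is `Sum.inr s`. -/
abbrev CRSpace (S : Type*) : Type _ := S ⊕ S → ℝ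

/-- `P_μ = {p | p(s^c) + p(t^r) ≥ μ(s,t) for all s, t}`. -/
def P {S : Type*} (μ : S → S → ℝ) : Set (CRSpace S) :=
  {p | ∀ s t, μ s t ≤ p (Sum.inl s) + p (Sum.inr t)}

/-- `Q_μ`, the set of minimal elements of `P_μ`. -/
def Q {S : Type*} (μ : S → S → ℝ) : Set (CRSpace S) :=
  {p | Minimal (fun q => q ∈ P μ) p}

/-- `R^+`, the set of nonnegative points of `R`. -/
def nonnegPart {S : Type*} (R : Set (CRSpace S)) : Set (CRSpace S) :=
  {p | p ∈ R ∧ ∀ u, 0 ≤ p u}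

/-- `R_s`, the set of points `p ∈ R` with `p(s^c) + p(s^r) = 0`. -/
def region {S : Type*} (R : Set (CRSpace S)) (s : S) : Set (CRSpace S) :=
  {p | p ∈ R ∧ p (Sum.inl s) + p (Sum.inr s) = 0}

/-- The point `μ_s`, with `μ_s(t^c) = μ(t,s)` and `μ_s(t^r) = μ(s,t)`. -/
def pt {S : Type*} (μ : S → S → ℝ) (s : S) : CRSpace S :=
  Sum.elim (fun t => μ t s) (fun t => μ s t)

/-- The bipartite graph `K(p)` on `S^{cr}` with edge set
`{s^c t^r | p(s^c) + p(t^r) = μ(s,t)}`. -/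
def K {S : Type*} (μ : S → S → ℝ) (p : CRSpace S) : SimpleGraph (S ⊕ S) where
  Adj a b :=
    (∃ s t, a = Sum.inl s ∧ b = Sum.inr t ∧ p (Sum.inl s) + p (Sum.inr t) = μ s t) ∨
    (∃ s t, b = Sum.inl s ∧ a = Sum.inr t ∧ p (Sum.inl s) + p (Sum.inr t) = μ s t)
  symm := ⟨fun _ _ h => h.symm⟩
  loopless := ⟨by
    rintro a (⟨s, t, h₁, h₂, -⟩ | ⟨s, t, h₁, h₂, -⟩) <;>
    exact Sum.inl_ne_inr (h₁.symm.trans h₂)⟩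

/-- `N_p(U)`: the nodes of `K(p)` outside `U` that are joined to some node of `U`. -/
def N {S : Type*} (μ : S → S → ℝ) (p : CRSpace S) (U : Set (S ⊕ S)) : Set (S ⊕ S) :=
  {v | v ∉ U ∧ ∃ u ∈ U, (K μ p).Adj u v}

/-! ### Fats, degenerate sets, the slimmed tropical polytope -/

/-- `𝒮₀`, the family of subsets of `S` on which `μ` vanishes. -/
def S0 {S : Type*} (μ : S → S → ℝ) : Set (Set S) :=
  {X | ∀ s ∈ X, ∀ t ∈ X, μ s t = 0}

/-- `Q_{μ,X}`: the points `p ∈ Q_μ` such that `s^c s^r` is an edge of `K(p)` iff `s ∈ X`. -/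
def QX {S : Type*} (μ : S → S → ℝ) (X : Set S) : Set (CRSpace S) :=
  {p | p ∈ Q μ ∧ ∀ s, (K μ p).Adj (Sum.inl s) (Sum.inr s) ↔ s ∈ X}

/-- `p` is a fat relative to `X`. -/
def IsFatRel {S : Type*} (μ : S → S → ℝ) (X : Set S) (p : CRSpace S) : Prop :=
  X ∈ S0 μ ∧ p ∈ QX μ X ∧
    (N μ p (Sum.inl '' Xᶜ) ⊆ Sum.inr '' Xᶜ ∨ N μ p (Sum.inr '' Xᶜ) ⊆ Sum.inl '' Xᶜ)

/-- `p` is a fat (relative to some `X`). -/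
def IsFat {S : Type*} (μ : S → S → ℝ) (p : CRSpace S) : Prop :=
  ∃ X, IsFatRel μ X p

/-- The degenerate set `Q_{μ,X}^{deg}` relative to `X`. -/
def Qdeg {S : Type*} (μ : S → S → ℝ) (X : Set S) : Set (CRSpace S) :=
  {p | p ∈ QX μ X ∧
    (N μ p (Sum.inl '' Xᶜ) = Sum.inr '' Xᶜ ∨ N μ p (Sum.inr '' Xᶜ) = Sum.inl '' Xᶜ)}

/-- A proper fat: a fat that belongs to no degenerate set. -/
def IsProperFat {S : Type*} (μ : S → S → ℝ) (p : CRSpace S) : Prop :=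
  IsFat μ p ∧ ∀ X ∈ S0 μ, p ∉ Qdeg μ X

/-- `Q_μ^{slim}`: `Q_μ` with all proper fats deleted. -/
def Qslim {S : Type*} (μ : S → S → ℝ) : Set (CRSpace S) :=
  {p | p ∈ Q μ ∧ ¬ IsProperFat μ p}

/-- The vector `(𝟏_{X^c}, -𝟏_{X^r})`; for `X = S` it is `(𝟏, -𝟏)`. -/
def shiftVec {S : Type*} (X : Set S) : CRSpace S :=
  Sum.elim (X.indicator fun _ => 1) (fun s => - X.indicator (fun _ => (1 : ℝ)) s)

/-- The relation `∼`: `p - q ∈ (𝟏,-𝟏)ℝ`, or for some `X ∈ 𝒮₀` both points lie in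
`Q_{μ,X}^{deg}` and `p - q ∈ (𝟏,-𝟏)ℝ + (𝟏_{X^c},-𝟏_{X^r})ℝ`. -/
def SlimRel {S : Type*} (μ : S → S → ℝ) (p q : CRSpace S) : Prop :=
  (∃ a : ℝ, p - q = a • shiftVec Set.univ) ∨
  ∃ X ∈ S0 μ, p ∈ Qdeg μ X ∧ q ∈ Qdeg μ X ∧
    ∃ a b : ℝ, p - q = a • shiftVec Set.univ + b • shiftVec X

theorem K_eq_of_sub {S : Type*} {μ : S → S → ℝ} {p q : CRSpace S} {a : ℝ}
    (h : p - q = a • shiftVec Set.univ) : K μ p = K μ q := by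
  have hs : ∀ s t, p (Sum.inl s) + p (Sum.inr t) = q (Sum.inl s) + q (Sum.inr t) := by
    intro s t
    have h₁ := congrFun h (Sum.inl s)
    have h₂ := congrFun h (Sum.inr t)
    simp [shiftVec] at h₁ h₂
    linarith
  ext x y
  simp only [K, hs]

theorem mem_Qdeg_of_sub {S : Type*} {μ : S → S → ℝ} {p q : CRSpace S} {a : ℝ} {X : Set S}
    (hq : q ∈ Q μ) (h : p - q = a • shiftVec Set.univ) (hp : p ∈ Qdeg μ X) : q ∈ Qdeg μ X := by
  have hK := K_eq_of_sub (μ := μ) h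
  obtain ⟨⟨-, h₂⟩, h₃⟩ := hp
  refine ⟨⟨hq, ?_⟩, ?_⟩
  · rw [← hK]; exact h₂
  · simpa only [N, hK] using h₃

theorem QX_unique {S : Type*} {μ : S → S → ℝ} {p : CRSpace S} {X Y : Set S}
    (hX : p ∈ QX μ X) (hY : p ∈ QX μ Y) : X = Y :=
  Set.ext fun s => (hX.2 s).symm.trans (hY.2 s)

/-- The equivalence relation `∼` on `Q_μ^{slim}`. -/
def slimSetoid {S : Type*} (μ : S → S → ℝ) : Setoid (Qslim μ) where
  r p q := SlimRel μ p.1 q.1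
  iseqv := by
    refine ⟨fun p => Or.inl ⟨0, by simp⟩, ?_, ?_⟩
    · rintro p q (⟨a, h⟩ | ⟨X, hX, hp, hq, a, b, h⟩)
      · exact Or.inl ⟨-a, by rw [← neg_sub, h, neg_smul]⟩
      · exact Or.inr ⟨X, hX, hq, hp, -a, -b, by
          rw [← neg_sub, h, neg_smul, neg_smul, neg_add]⟩
    · rintro p q r (⟨a, h⟩ | ⟨X, hX, hp, hq, a, b, h⟩) (⟨a', h'⟩ | ⟨Y, hY, hq', hr, a', b', h'⟩)
      · exact Or.inl ⟨a + a', by rw [← sub_add_sub_cancel, h, h', add_smul]⟩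
      · have hp : p.1 ∈ Qdeg μ Y :=
          mem_Qdeg_of_sub (a := -a) p.2.1 (by rw [← neg_sub, h, neg_smul]) hq'
        exact Or.inr ⟨Y, hY, hp, hr, a + a', b', by
          rw [← sub_add_sub_cancel, h, h', add_smul, add_assoc]⟩
      · exact Or.inr ⟨X, hX, hp, mem_Qdeg_of_sub r.2.1 h' hq, a + a', b, by
          rw [← sub_add_sub_cancel, h, h', add_smul]; abel⟩
      · obtain rfl := QX_unique hq.1 hq'.1
        exact Or.inr ⟨X, hX, hp, hr, a + a', b + b', by
          rw [← sub_add_sub_cancel, h, h', add_smul, add_smul]; abel⟩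

/-- The slimmed tropical polytope `Q_μ^{slim}/∼`. -/
def SlimPolytope {S : Type*} (μ : S → S → ℝ) : Type _ := Quotient (slimSetoid μ)

/-- The projection `Q_μ^{slim} → Q_μ^{slim}/∼`. -/
def slimProj {S : Type*} (μ : S → S → ℝ) (p : Qslim μ) : SlimPolytope μ :=
  Quotient.mk (slimSetoid μ) p

/-- A section: a subset of `Q_μ^{slim}` projected bijectively onto `Q_μ^{slim}/∼`. -/
def IsSection {S : Type*} (μ : S → S → ℝ) (R : Set (CRSpace S)) : Prop :=
  R ⊆ Qslim μ ∧ Set.BijOn (slimProj μ) {p | (p : CRSpace S) ∈ R} Set.univ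

/-- A balanced set: no two of its points satisfy `p^c < q^c` or `p^r < q^r`
(strict inequality in every coordinate). -/
def IsBalanced {S : Type*} (R : Set (CRSpace S)) : Prop :=
  ¬ ∃ p ∈ R, ∃ q ∈ R,
    (∀ s, p (Sum.inl s) < q (Sum.inl s)) ∨ (∀ s, p (Sum.inr s) < q (Sum.inr s))

/-- A slimmed section in `(Q_μ^{slim})^+`: a balanced section such that for no `X ∈ 𝒮₀` there
is a pair of distinct points of `R` in `(Q_{μ,X}^{deg})^+` with `p(s^c) < q(s^c)` for all
`s ∉ X`, or `p(s^r) < q(s^r)` for all `s ∉ X`. -/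
def IsSlimmedSection {S : Type*} (μ : S → S → ℝ) (R : Set (CRSpace S)) : Prop :=
  R ⊆ nonnegPart (Qslim μ) ∧ IsSection μ R ∧ IsBalanced R ∧
  ∀ X ∈ S0 μ, ¬ ∃ p ∈ R ∩ nonnegPart (Qdeg μ X), ∃ q ∈ R ∩ nonnegPart (Qdeg μ X), p ≠ q ∧
    ((∀ s ∉ X, p (Sum.inl s) < q (Sum.inl s)) ∨ (∀ s ∉ X, p (Sum.inr s) < q (Sum.inr s)))

/-! ### Oriented trees -/

/-- An oriented tree: a directed graph without antiparallel edges (and hence without loops)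
whose underlying undirected graph is a tree. -/
structure OrientedTree (V : Type*) extends Digraph V where
  asymm : ∀ u v, Adj u v → ¬ Adj v u
  isTree : toDigraph.toSimpleGraphInclusive.IsTree

/-- The underlying undirected tree. -/
abbrev OrientedTree.graph {V : Type*} (Γ : OrientedTree V) : SimpleGraph V :=
  Γ.toDigraph.toSimpleGraphInclusive

/-- The unique path from `u` to `v` in the underlying tree. -/
def OrientedTree.path {V : Type*} (Γ : OrientedTree V) (u v : V) : Γ.graph.Walk u v :=
  (Γ.isTree.existsUnique_path u v).choose

open Classical in
/-- `D_{Γ,α}(u,v)`: the sum of `α(pq)` over the edges `pq` of `Γ` that the path from `u` to `v`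
traverses from `p` to `q`; edges traversed backwards are not counted. -/
def OrientedTree.dist {V : Type*} (Γ : OrientedTree V) (α : V → V → ℝ) (u v : V) : ℝ :=
  ((Γ.path u v).darts.map fun d => if Γ.Adj d.fst d.snd then α d.fst d.snd else 0).sum

/-- `(Γ, α; {F_s})` is an oriented-tree realization of `μ`. Here `α u v` is the length of the
edge `uv` (its values at non-edges play no role), and a subgraph of `Γ` is recorded by its
underlying undirected subgraph, whose edges inherit their orientations from `Γ`. -/
structure IsRealization {S V : Type*} (μ : S → S → ℝ) (Γ : OrientedTree V) (α : V → V → ℝ)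
    (F : S → Γ.graph.Subgraph) : Prop where
  length_nonneg : ∀ u v, Γ.Adj u v → 0 ≤ α u v
  subtree : ∀ s, (F s).coe.IsTree
  dist_eq : ∀ s t,
    μ s t = sInf {x | ∃ u ∈ (F s).verts, ∃ v ∈ (F t).verts, x = Γ.dist α u v}

/-- The subgraph consists of the single node `v`. -/
def IsNode {V : Type*} {Γ : OrientedTree V} (H : Γ.graph.Subgraph) (v : V) : Prop :=
  H.verts = {v}

/-- The subgraph is a directed path of `Γ`. -/
def IsDirectedPath {V : Type*} {Γ : OrientedTree V} (H : Γ.graph.Subgraph) : Prop :=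
  ∃ (u v : V) (w : Γ.graph.Walk u v), w.IsPath ∧ (∀ d ∈ w.darts, Γ.Adj d.fst d.snd) ∧
    H = w.toSubgraph

/-- The union of the segments `[μ_s, μ_t]` over `s, t` such that `F_s`, `F_t` are single nodes
`v_s`, `v_t` and `v_s v_t` is a (directed) edge of `H`, together with the points `μ_s` where
`F_s` is a single node `v_s` of `H`. The points are redundant unless `H` has a single node. -/
def segmentUnion {S V : Type*} (μ : S → S → ℝ) (Γ : OrientedTree V)
    (F : S → Γ.graph.Subgraph) (H : Γ.graph.Subgraph) : Set (CRSpace S) :=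
  {p | ∃ s v, IsNode (F s) v ∧ v ∈ H.verts ∧ p = pt μ s} ∪
  {p | ∃ s t u v, IsNode (F s) u ∧ IsNode (F t) v ∧ Γ.Adj u v ∧ H.Adj u v ∧
    p ∈ segment ℝ (pt μ s) (pt μ t)}

end DirectedMultiflow

end

/-!
Identify a node `v` of `Γ` with the index of its one-node subtree. Let `p` be a nonnegative point
of `Q_μ` and `v` a node with `p(v^c) > 0`. If `p(v^c) + p(t^r) = μ(v,t)`, then `p(t^r) < μ(v,t)`,
and this excludes that `v` separates `F_t` from any `F_s` for which `p(s^c)` is small: tight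
partners point in a definite direction of the tree.

If `p^c` vanishes at a node `u` and `p^r` vanishes at a node `v`, then at no node on the path from
`u` to `v` are both positive, and so `p^c` and `p^r` vanish together at one node or at opposite ends
of an edge; accordingly `p` is some `μ_v` or lies on the segment of that edge. If `p^c` is positive
at all nodes, suppose that every node `u` has a tight partner `s` with `p(s^c) > 0`, and let `u`
point to its neighbour towards `F_s`. In a finite tree two neighbours point to each other, and this
is impossible because one of the two directions of their edge has length zero. A node with no such
partner makes `p` a proper fat.
-/

namespace DirectedMultiflow

open SimpleGraph
open Sum (inl inr)

/-! ### Separation in trees -/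

section Separates

variable {V : Type*} {G : SimpleGraph V} {u v x y : V} {A B C : Set V}

/-- The node `x` separates `A` from `B` if every walk from `A` to `B` passes through `x`; the
node `x` itself may belong to `A` or `B`. -/
def Separates (G : SimpleGraph V) (x : V) (A B : Set V) : Prop :=
  ∀ a ∈ A, ∀ b ∈ B, ∀ w : G.Walk a b, x ∈ w.support

theorem Separates.symm (h : Separates G x A B) : Separates G x B A :=
  fun b hb a ha w => by simpa using h a ha b hb w.reverse

theorem Separates.mono_right (h : Separates G x A C) (hBC : B ⊆ C) : Separates G x A B :=
  fun a ha b hb => h a ha b (hBC hb)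

theorem not_separates_singleton_self (h : u ≠ v) : ¬ Separates G u {v} {v} :=
  fun hs => h (by simpa using hs v rfl v rfl Walk.nil)

theorem not_separates_trans (hB : (G.induce B).Preconnected) (hx : x ∉ B)
    (hAB : ¬ Separates G x A B) (hBC : ¬ Separates G x B C) : ¬ Separates G x A C := by
  simp only [Separates, not_forall] at hAB hBC
  obtain ⟨a, ha, b, hb, w, hw⟩ := hAB
  obtain ⟨b', hb', c, hc, w', hw'⟩ := hBC
  obtain ⟨r⟩ := hB ⟨b, hb⟩ ⟨b', hb'⟩
  let r' : G.Walk b b' := r.map (Embedding.induce B).toHom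
  have hr : x ∉ r'.support := fun h => by
    obtain ⟨y, -, rfl⟩ := List.mem_map.1 (Walk.support_map _ r ▸ h)
    exact hx y.2
  intro h
  simpa [Walk.mem_support_append_iff, hw, hr, hw'] using h a ha c hc ((w.append r').append w')

theorem not_separates_singleton_of_mem (hB : (G.induce B).Preconnected) (hx : x ∉ B) (hy : y ∈ B)
    (h : ¬ Separates G x A B) : ¬ Separates G x A {y} :=
  not_separates_trans hB hx h fun hs =>
    not_separates_singleton_self (ne_of_mem_of_not_mem hy hx).symm fun _ ha => hs _ (ha ▸ hy)

theorem separates_singleton_or_of_adj (hG : G.IsAcyclic) (h : G.Adj u v) (y : V) :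
    Separates G u {v} {y} ∨ Separates G v {u} {y} := by
  by_contra! hn
  simp only [Separates, Set.mem_singleton_iff, forall_eq, not_forall] at hn
  obtain ⟨⟨p, hp⟩, q, hq⟩ := hn
  have hbridge := isBridge_iff_forall_walk_mem_edges.1
    (isAcyclic_iff_forall_adj_isBridge.1 hG h) (q.append p.reverse)
  rw [Walk.edges_append, List.mem_append] at hbridge
  rcases hbridge with he | he
  · exact hq (q.snd_mem_support_of_mem_edges he)
  · exact hp (by simpa using p.reverse.fst_mem_support_of_mem_edges he)

theorem separates_or_mem_of_adj (hG : G.IsAcyclic) (hA : (G.induce A).Preconnected)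
    (h : G.Adj u v) : Separates G u {v} A ∨ Separates G v {u} A ∨ u ∈ A ∧ v ∈ A := by
  by_contra! hn
  obtain ⟨hu, hv, huv⟩ := hn
  have exists_mem : ∀ {x y : V}, ¬ Separates G x {y} A → ∃ z ∈ A, ¬ Separates G x {y} {z} := by
    simp only [Separates, Set.mem_singleton_iff, forall_eq, not_forall, exists_prop]
    exact fun h => h
  by_cases huA : u ∈ A
  · obtain ⟨z, hz, hsep⟩ := exists_mem hu
    exact (separates_singleton_or_of_adj hG h z).elim hsep
      (not_separates_singleton_of_mem hA (huv huA) hz hv)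
  · obtain ⟨z, hz, hsep⟩ := exists_mem hv
    exact (separates_singleton_or_of_adj hG h z).elim
      (not_separates_singleton_of_mem hA huA hz hu) hsep

theorem exists_adj_not_separates (hG : G.Connected) (h : x ≠ y) :
    ∃ z, G.Adj x z ∧ G.dist z y < G.dist x y ∧ ¬ Separates G x {z} {y} := by
  obtain ⟨w, hw, hlen⟩ := hG.exists_path_of_dist x y
  cases w with
  | nil => exact absurd rfl h
  | @cons _ z _ hz r =>
    rw [Walk.cons_isPath_iff] at hw
    exact ⟨z, hz, (dist_le r).trans_lt (by rw [← hlen, Walk.length_cons]; omega),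
      fun hs => hw.2 (hs z rfl y rfl r)⟩

theorem exists_mem_separates_of_disjoint (hG : G.IsTree) (hA : (G.induce A).Connected)
    (hB : (G.induce B).Connected) (hAB : Disjoint A B) : ∃ x ∈ B, Separates G x A B := by
  obtain ⟨y, hy⟩ := hA.nonempty
  obtain ⟨x₀, hx₀⟩ := hB.nonempty
  let nearest := Function.argminOn (G.dist · y) B ⟨x₀, hx₀⟩
  have hxB : nearest ∈ B := Function.argminOn_mem ..
  have hmin : ∀ z ∈ B, G.dist nearest y ≤ G.dist z y := fun z hz =>
    Function.argminOn_le (G.dist · y) B hz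
  generalize nearest = x at hxB hmin
  have hxA : x ∉ A := fun h => hAB.ne_of_mem h hxB rfl
  obtain ⟨z, hxz, hlt, hzy⟩ := exists_adj_not_separates hG.connected fun e : x = y => hxA (e ▸ hy)
  have hzB : z ∉ B := fun h => hlt.not_ge (hmin z h)
  have hzsep : Separates G x {z} B := by
    rcases separates_or_mem_of_adj hG.isAcyclic hB.preconnected hxz with hs | hs | hs
    · exact hs
    · exact absurd (hs.mono_right (Set.singleton_subset_iff.2 hxB))
        (not_separates_singleton_self hxz.ne')
    · exact absurd hs.2 hzB
  by_contra! hn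
  exact not_separates_trans hA.preconnected hxA
    (fun hs => hzy (hs.mono_right (Set.singleton_subset_iff.2 hy))) (hn x hxB) hzsep

theorem separates_of_mem_support (hG : G.IsAcyclic) {w : G.Walk u v} (hw : w.IsPath)
    (hx : x ∈ w.support) : Separates G x {u} {v} := by
  classical
  rintro _ rfl _ rfl w'
  have heq : w = w'.bypass := congrArg Subtype.val
    ((hG.subsingleton_path _ _).elim ⟨w, hw⟩ ⟨w'.bypass, w'.bypass_isPath⟩)
  exact w'.support_bypass_subset_support (heq ▸ hx)

-- A tree has more nodes than edges, so `v ↦ s(v, n v)` cannot be injective.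
theorem exists_involutive_neighbor [Finite V] (hG : G.IsTree) {n : V → V}
    (hn : ∀ v, G.Adj v (n v)) : ∃ v, n (n v) = v := by
  classical
  have := Fintype.ofFinite V
  have hcard : G.edgeFinset.card < (Finset.univ : Finset V).card := by
    rw [Finset.card_univ, ← hG.card_edgeFinset]
    exact Nat.lt_succ_self _
  obtain ⟨u, -, v, -, huv, he⟩ := Finset.exists_ne_map_eq_of_card_lt_of_maps_to hcard
    (f := fun v => s(v, n v)) fun v _ => mem_edgeFinset.2 (hn v)
  obtain ⟨rfl, -⟩ | ⟨hu, hv⟩ := Sym2.eq_iff.1 he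
  · exact absurd rfl huv
  · exact ⟨u, by rw [hv, ← hu]⟩

end Separates

/-! ### Tight pairs and fats -/

section Tight

variable {S : Type*} {μ : S → S → ℝ} {p q : CRSpace S} {X : Set S} {r r' s t x : S}

/-- The pair `s^c t^r` is an edge of `K(p)`. -/
abbrev Tight (μ : S → S → ℝ) (p : CRSpace S) (s t : S) : Prop :=
  p (inl s) + p (inr t) = μ s t

theorem K_adj_iff_tight : (K μ p).Adj (inl s) (inr t) ↔ Tight μ p s t := by
  simp [K]

theorem N_inl_image (A : Set S) : N μ p (inl '' A) = inr '' {t | ∃ s ∈ A, Tight μ p s t} := by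
  ext (_ | _) <;> simp [N, K]

theorem N_inr_image (A : Set S) : N μ p (inr '' A) = inl '' {s | ∃ t ∈ A, Tight μ p s t} := by
  ext (_ | _) <;> simp [N, K]

theorem comp_swap_mem_P (hp : p ∈ P μ) : p ∘ Sum.swap ∈ P (flip μ) :=
  fun s t => (hp t s).trans_eq (add_comm _ _)

theorem comp_swap_mem_Q (hp : p ∈ Q μ) : p ∘ Sum.swap ∈ Q (flip μ) :=
  ⟨comp_swap_mem_P hp.1, fun q hq hle u => by
    simpa using hp.2 (comp_swap_mem_P hq) (fun u => by simpa using hle u.swap) u.swap⟩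

theorem comp_swap_mem_nonnegPart_Q (hp : p ∈ nonnegPart (Q μ)) :
    p ∘ Sum.swap ∈ nonnegPart (Q (flip μ)) :=
  ⟨comp_swap_mem_Q hp.1, fun u => hp.2 u.swap⟩

theorem Tight.comp_swap (h : Tight μ p s t) : Tight (flip μ) (p ∘ Sum.swap) t s :=
  (add_comm _ _).trans h

theorem exists_tight_right [Finite S] (hp : p ∈ Q μ) (s : S) : ∃ t, Tight μ p s t := by
  classical
  have : Nonempty S := ⟨s⟩
  obtain ⟨t, ht⟩ := Finite.exists_min fun t => p (inl s) + p (inr t) - μ s t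
  set slack := p (inl s) + p (inr t) - μ s t
  have hslack : 0 ≤ slack := sub_nonneg.2 (hp.1 s t)
  have hq : Function.update p (inl s) (p (inl s) - slack) ∈ P μ := fun s' t' => by
    rcases eq_or_ne s' s with rfl | hs
    · simp only [Function.update_self, ne_eq, reduceCtorEq, not_false_eq_true,
        Function.update_of_ne]
      linarith [ht t']
    · simpa [hs] using hp.1 s' t'
  have hle := hp.2 hq (update_le_self_iff.2 (by linarith)) (inl s)
  rw [Function.update_self] at hle
  exact ⟨t, by linarith⟩

theorem exists_tight_left [Finite S] (hp : p ∈ Q μ) (t : S) : ∃ s, Tight μ p s t :=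
  (exists_tight_right (comp_swap_mem_Q hp) t).imp fun _ h => h.comp_swap

theorem exists_tight_right_lt [Finite S] (hp : p ∈ Q μ) (hs : 0 < p (inl s)) :
    ∃ t, Tight μ p s t ∧ p (inr t) < μ s t :=
  (exists_tight_right hp s).imp fun t ht => ⟨ht, by linarith⟩

theorem exists_tight_left_lt [Finite S] (hp : p ∈ Q μ) (ht : 0 < p (inr t)) :
    ∃ s, Tight μ p s t ∧ p (inl s) < μ s t :=
  (exists_tight_left hp t).imp fun s hs => ⟨hs, by linarith⟩

theorem mem_Q_of_tight (hp : p ∈ P μ) (hright : ∀ s, ∃ t, Tight μ p s t)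
    (hleft : ∀ t, ∃ s, Tight μ p s t) : p ∈ Q μ := by
  refine ⟨hp, fun q hq hle => ?_⟩
  rintro (s | t)
  · obtain ⟨t, ht⟩ := hright s
    linarith [hq s t, hle (inr t)]
  · obtain ⟨s, hs⟩ := hleft t
    linarith [hq s t, hle (inl s)]

theorem convex_P : Convex ℝ (P μ) := by
  intro p hp q hq c d hc hd hcd s t
  simp only [Pi.add_apply, Pi.smul_apply, smul_eq_mul]
  calc μ s t = c * μ s t + d * μ s t := by rw [← add_mul, hcd, one_mul]
    _ ≤ c * (p (inl s) + p (inr t)) + d * (q (inl s) + q (inr t)) := by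
      gcongr
      exacts [hp s t, hq s t]
    _ = _ := by ring

theorem eq_pt_of_eq_zero (hp : p ∈ Q μ) (hr : pt μ r ∈ P μ) (hl : p (inl r) = 0)
    (hr' : p (inr r) = 0) : p = pt μ r := by
  refine Minimal.eq_of_ge hp hr ?_
  rintro (s | s)
  · simpa [pt, hr'] using hp.1 s r
  · simpa [pt, hl] using hp.1 r s

theorem add_smul_shiftVec_univ_apply_add (c : ℝ) (s t : S) :
    (p + c • shiftVec Set.univ : CRSpace S) (inl s) +
        (p + c • shiftVec Set.univ : CRSpace S) (inr t) =
      p (inl s) + p (inr t) := by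
  simp only [shiftVec, Pi.add_apply, Pi.smul_apply, Sum.elim_inl, Sum.elim_inr,
    Set.indicator_univ, smul_eq_mul]
  ring

theorem add_smul_shiftVec_univ_mem_Q [Finite S] (hp : p ∈ Q μ) (c : ℝ) :
    p + c • shiftVec Set.univ ∈ Q μ := by
  refine mem_Q_of_tight (fun s t => ?_) (fun s => ?_) fun t => ?_
  · rw [add_smul_shiftVec_univ_apply_add]
    exact hp.1 s t
  · simpa only [Tight, add_smul_shiftVec_univ_apply_add] using exists_tight_right hp s
  · simpa only [Tight, add_smul_shiftVec_univ_apply_add] using exists_tight_left hp t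

theorem isFat_congr (hp : p ∈ Q μ) (hq : q ∈ Q μ) (h : K μ p = K μ q) :
    IsFat μ p ↔ IsFat μ q := by
  simp only [IsFat, IsFatRel, QX, N, Set.mem_ofPred_eq, hp, hq, h]

theorem isProperFat_congr (hp : p ∈ Q μ) (hq : q ∈ Q μ) (h : K μ p = K μ q) :
    IsProperFat μ p ↔ IsProperFat μ q := by
  simp only [IsProperFat, isFat_congr hp hq h, Qdeg, QX, N, Set.mem_ofPred_eq, hp, hq, h]

theorem N_inl_image_compl_subset_iff :
    N μ p (inl '' Xᶜ) ⊆ inr '' Xᶜ ↔ ∀ s t, Tight μ p s t → t ∈ X → s ∈ X := by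
  rw [N_inl_image, Set.image_subset_image_iff Sum.inr_injective]
  exact ⟨fun h s t hst ht => by_contra fun hs => h ⟨s, hs, hst⟩ ht,
    fun h t ⟨s, hs, hst⟩ ht => hs (h s t hst ht)⟩

theorem N_inr_image_compl_subset_iff :
    N μ p (inr '' Xᶜ) ⊆ inl '' Xᶜ ↔ ∀ s t, Tight μ p s t → s ∈ X → t ∈ X := by
  rw [N_inr_image, Set.image_subset_image_iff Sum.inl_injective]
  exact ⟨fun h s t hst hs => by_contra fun ht => h ⟨t, ht, hst⟩ hs,
    fun h s ⟨t, ht, hst⟩ hs => ht (h s t hst hs)⟩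

theorem inr_image_compl_subset_N_iff :
    inr '' Xᶜ ⊆ N μ p (inl '' Xᶜ) ↔ ∀ t ∉ X, ∃ s ∉ X, Tight μ p s t := by
  rw [N_inl_image, Set.image_subset_image_iff Sum.inr_injective]
  rfl

theorem inl_image_compl_subset_N_iff :
    inl '' Xᶜ ⊆ N μ p (inr '' Xᶜ) ↔ ∀ s ∉ X, ∃ t ∉ X, Tight μ p s t := by
  rw [N_inr_image, Set.image_subset_image_iff Sum.inl_injective]
  rfl

theorem isFat_iff (hX : X ∈ S0 μ) (hp : p ∈ QX μ X) :
    IsFat μ p ↔ (∀ s t, Tight μ p s t → t ∈ X → s ∈ X) ∨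
      ∀ s t, Tight μ p s t → s ∈ X → t ∈ X := by
  rw [← N_inl_image_compl_subset_iff, ← N_inr_image_compl_subset_iff]
  refine ⟨?_, fun h => ⟨X, hX, hp, h⟩⟩
  rintro ⟨Y, -, hY, h⟩
  rwa [QX_unique hp hY]

theorem isProperFat_iff [Finite S] (hX : X ∈ S0 μ) (hp : p ∈ QX μ X) :
    IsProperFat μ p ↔
      ((∀ s t, Tight μ p s t → t ∈ X → s ∈ X) ∧ ∃ t ∉ X, ∀ s, Tight μ p s t → s ∈ X) ∨
      ((∀ s t, Tight μ p s t → s ∈ X → t ∈ X) ∧ ∃ s ∉ X, ∀ t, Tight μ p s t → t ∈ X) := by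
  have hdeg : (∀ Y ∈ S0 μ, p ∉ Qdeg μ Y) ↔ p ∉ Qdeg μ X :=
    ⟨fun h => h X hX, fun h Y _ hY => h (QX_unique hp hY.1 ▸ hY)⟩
  rw [IsProperFat, hdeg, isFat_iff hX hp]
  simp only [Qdeg, Set.mem_ofPred_eq, hp, true_and, Set.Subset.antisymm_iff,
    N_inl_image_compl_subset_iff, N_inr_image_compl_subset_iff, inr_image_compl_subset_N_iff,
    inl_image_compl_subset_N_iff]
  constructor
  · rintro ⟨h | h, hd⟩
    · refine Or.inl ⟨h, by_contra fun hn => hd (Or.inl ⟨h, fun t ht => ?_⟩)⟩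
      by_contra! hs
      exact hn ⟨t, ht, fun s hst => by_contra fun hsX => hs s hsX hst⟩
    · refine Or.inr ⟨h, by_contra fun hn => hd (Or.inr ⟨h, fun s hs => ?_⟩)⟩
      by_contra! ht
      exact hn ⟨s, hs, fun t hst => by_contra fun htX => ht t htX hst⟩
  · rintro (⟨h, t, ht, hts⟩ | ⟨h, s, hs, hst⟩)
    · refine ⟨Or.inl h, ?_⟩
      obtain ⟨s, hs⟩ := exists_tight_left hp.1 t
      rintro (⟨-, hd⟩ | ⟨hR, -⟩)
      · obtain ⟨s', hs', hst'⟩ := hd t ht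
        exact hs' (hts s' hst')
      · exact ht (hR s t hs (hts s hs))
    · refine ⟨Or.inr h, ?_⟩
      obtain ⟨t, ht⟩ := exists_tight_right hp.1 s
      rintro (⟨hL, -⟩ | ⟨-, hd⟩)
      · exact hs (hL s t ht (hst t ht))
      · obtain ⟨t', ht', hst'⟩ := hd s hs
        exact ht' (hst t' hst')

/-- The set of all `s` with `p(s^c) = p(s^r) = 0`. It is the set `X` with `p ∈ Q_{μ,X}` when `p`
is nonnegative, see `mem_QX_zeroSet`. -/
def zeroSet (p : CRSpace S) : Set S :=
  {s | p (inl s) = 0 ∧ p (inr s) = 0}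

theorem mem_QX_zeroSet (hμ : ∀ s, μ s s = 0) (hp : p ∈ nonnegPart (Q μ)) :
    p ∈ QX μ (zeroSet p) :=
  ⟨hp.1, fun s => by
    rw [K_adj_iff_tight, Tight, hμ, add_eq_zero_iff_of_nonneg (hp.2 _) (hp.2 _)]
    rfl⟩

theorem zeroSet_mem_S0 (hμ : ∀ s t, 0 ≤ μ s t) (hp : p ∈ P μ) : zeroSet p ∈ S0 μ :=
  fun s hs t ht => le_antisymm (by simpa [hs.1, ht.2] using hp s t) (hμ s t)

theorem mem_zeroSet_of_tight_left_closed (hμ : ∀ s t, 0 ≤ μ s t) (hp : p ∈ Q μ)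
    (hr : pt μ r ∈ P μ) (hpr : p (inl r) = 0) (hx : x ∈ zeroSet p)
    (h : ∀ s t, Tight μ p s t → t ∈ zeroSet p → s ∈ zeroSet p) (s : S) : s ∈ zeroSet p := by
  have hrx : μ r x ≤ 0 := by simpa [hpr, hx.2] using hp.1 r x
  have hr0 : r ∈ zeroSet p := h r x (by rw [Tight, hpr, hx.2]; linarith [hμ r x]) hx
  have heq := eq_pt_of_eq_zero hp hr hpr hr0.2
  exact h s r (by rw [Tight, hr0.2, heq]; simp [pt]) hr0

theorem pt_flip_mem_P (hr : pt μ r ∈ P μ) : pt (flip μ) r ∈ P (flip μ) := by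
  convert comp_swap_mem_P hr
  ext (_ | _) <;> rfl

theorem mem_zeroSet_of_tight_right_closed (hμ : ∀ s t, 0 ≤ μ s t) (hp : p ∈ Q μ)
    (hr : pt μ r ∈ P μ) (hpr : p (inr r) = 0) (hx : x ∈ zeroSet p)
    (h : ∀ s t, Tight μ p s t → s ∈ zeroSet p → t ∈ zeroSet p) (s : S) : s ∈ zeroSet p :=
  (mem_zeroSet_of_tight_left_closed (fun s t => hμ t s) (comp_swap_mem_Q hp) (pt_flip_mem_P hr) hpr
    hx.symm (fun s t hst ht => (h t s hst.comp_swap ht.symm).symm) s).symm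

theorem not_isFat_of_eq_zero (hμ : ∀ s t, 0 ≤ μ s t) (hdiag : ∀ s, μ s s = 0)
    (hne : ∃ s t, μ s t ≠ 0) (hp : p ∈ nonnegPart (Q μ)) (hr : pt μ r ∈ P μ) (hpr : p (inl r) = 0)
    (hr' : pt μ r' ∈ P μ) (hpr' : p (inr r') = 0) (hx : x ∈ zeroSet p) : ¬ IsFat μ p := by
  have hS0 := zeroSet_mem_S0 hμ hp.1.1
  obtain ⟨s, t, hst⟩ := hne
  rw [isFat_iff hS0 (mem_QX_zeroSet hdiag hp)]
  rintro (h | h)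
  · have := mem_zeroSet_of_tight_left_closed hμ hp.1 hr hpr hx h
    exact hst (hS0 s (this s) t (this t))
  · have := mem_zeroSet_of_tight_right_closed hμ hp.1 hr' hpr' hx h
    exact hst (hS0 s (this s) t (this t))

theorem not_isProperFat_of_eq_zero [Finite S] (hμ : ∀ s t, 0 ≤ μ s t) (hdiag : ∀ s, μ s s = 0)
    (hp : p ∈ nonnegPart (Q μ)) (hr : pt μ r ∈ P μ) (hpr : p (inl r) = 0)
    (hr' : pt μ r' ∈ P μ) (hpr' : p (inr r') = 0) : ¬ IsProperFat μ p := by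
  rw [isProperFat_iff (zeroSet_mem_S0 hμ hp.1.1) (mem_QX_zeroSet hdiag hp)]
  rintro (⟨h, t, ht, hts⟩ | ⟨h, s, hs, hst⟩)
  · obtain ⟨s, hs⟩ := exists_tight_left hp.1 t
    exact ht (mem_zeroSet_of_tight_left_closed hμ hp.1 hr hpr (hts s hs) h t)
  · obtain ⟨t, ht⟩ := exists_tight_right hp.1 s
    exact hs (mem_zeroSet_of_tight_right_closed hμ hp.1 hr' hpr' (hst t ht) h s)

end Tight

/-! ### Distances between subtrees -/

/-- The properties of a distance `μ` between subtrees `T s` of a tree `G` that determine the slimmed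
tropical polytope: `σ v` is an index whose subtree is the node `v`, so that `μ (σ u) (σ v)` stands
for the distance from `u` to `v`. The properties are invariant under `flip μ`, see
`IsSubtreeDistance.flip`. -/
structure IsSubtreeDistance {S V : Type*} (G : SimpleGraph V) (T : S → Set V) (σ : V → S)
    (μ : S → S → ℝ) : Prop where
  isTree : G.IsTree
  connected : ∀ s, (G.induce (T s)).Connected
  node : ∀ v, T (σ v) = {v}
  nonneg : ∀ s t, 0 ≤ μ s t
  right_eq_zero : ∀ {v s}, v ∈ T s → μ s (σ v) = 0
  left_eq_zero : ∀ {v s}, v ∈ T s → μ (σ v) s = 0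
  triangle : ∀ s t v, μ s t ≤ μ s (σ v) + μ (σ v) t
  additive : ∀ {v s t}, Separates G v (T s) (T t) → μ s t = μ s (σ v) + μ (σ v) t
  oneWay : ∀ {u v}, G.Adj u v → μ (σ u) (σ v) = 0 ∨ μ (σ v) (σ u) = 0

namespace IsSubtreeDistance

variable {S V : Type*} {G : SimpleGraph V} {T : S → Set V} {σ : V → S} {μ : S → S → ℝ}
  {p q : CRSpace S} {X : Set S} {s t : S} {u v x : V} {c d : ℝ}
  (H : IsSubtreeDistance G T σ μ)

include H

theorem flip : IsSubtreeDistance G T σ (flip μ) where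
  isTree := H.isTree
  connected := H.connected
  node := H.node
  nonneg s t := H.nonneg t s
  right_eq_zero := H.left_eq_zero
  left_eq_zero := H.right_eq_zero
  triangle s t v := (H.triangle t s v).trans_eq (add_comm _ _)
  additive h := (H.additive h.symm).trans (add_comm _ _)
  oneWay h := (H.oneWay h).symm

theorem preconnected (s : S) : (G.induce (T s)).Preconnected :=
  (H.connected s).preconnected

theorem node_self (v : V) : μ (σ v) (σ v) = 0 :=
  H.right_eq_zero (H.node v ▸ rfl)

theorem diag (s : S) : μ s s = 0 := by
  obtain ⟨v, hv⟩ := (H.connected s).nonempty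
  refine le_antisymm ?_ (H.nonneg s s)
  simpa [H.right_eq_zero hv, H.left_eq_zero hv] using H.triangle s s v

theorem pt_mem_P (v : V) : pt μ (σ v) ∈ P μ :=
  fun s t => H.triangle s t v

theorem eq_add_of_separates_node (h : Separates G x {u} (T t)) :
    μ (σ u) t = μ (σ u) (σ x) + μ (σ x) t :=
  H.additive (by rwa [H.node])

theorem eq_or_eq_of_adj (h : G.Adj u v) (hvu : μ (σ v) (σ u) = 0) (s : S) :
    μ s (σ v) = μ s (σ u) + μ (σ u) (σ v) ∨ μ s (σ v) = μ s (σ u) := by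
  rcases separates_or_mem_of_adj H.isTree.isAcyclic (H.preconnected s) h with hs | hs | ⟨hu, hv⟩
  · exact Or.inl (H.flip.eq_add_of_separates_node hs |>.trans (add_comm _ _))
  · refine Or.inr ?_
    have := H.flip.eq_add_of_separates_node hs
    simp only [_root_.flip, hvu, zero_add] at this
    exact this.symm
  · exact Or.inr ((H.right_eq_zero hv).trans (H.right_eq_zero hu).symm)

theorem not_separates_of_lt (hp : p ∈ P μ)
    (h : p (inl s) + p (inr t) < μ s (σ x) + μ (σ x) t) : ¬ Separates G x (T s) (T t) :=
  fun hx => (h.trans_eq (H.additive hx).symm).not_ge (hp s t)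

theorem not_separates_node_of_lt (hp : p ∈ P μ) (hv : p (inl (σ v)) = 0)
    (ht : p (inr t) < μ (σ x) t) : ¬ Separates G x {v} (T t) := by
  rw [← H.node v]
  exact H.not_separates_of_lt hp (by linarith [H.nonneg (σ v) (σ x)])

theorem notMem_of_lt (hp : p ∈ nonnegPart (Q μ)) (ht : p (inr t) < μ (σ x) t) : x ∉ T t :=
  fun hx => (ht.trans_eq (H.left_eq_zero hx)).not_ge (hp.2 _)

/-! ### Points with a zero on both sides -/

section NonnegPart

variable (hp : p ∈ nonnegPart (Q μ))

include hp

theorem not_separates_of_pos [Finite S] (hv : p (inl (σ v)) = 0) (hu : p (inr (σ u)) = 0)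
    (hl : 0 < p (inl (σ x))) (hr : 0 < p (inr (σ x))) : ¬ Separates G x {v} {u} := by
  have hp' := comp_swap_mem_nonnegPart_Q hp
  obtain ⟨t, -, ht⟩ := exists_tight_right_lt hp.1 hl
  obtain ⟨s, -, hs⟩ := exists_tight_left_lt hp.1 hr
  have hvt := H.not_separates_node_of_lt hp.1.1 hv ht
  have hsu := mt Separates.symm (H.flip.not_separates_node_of_lt hp'.1.1 hu hs)
  have hst : ¬ Separates G x (T s) (T t) := H.not_separates_of_lt hp.1.1 (add_lt_add hs ht)
  exact not_separates_trans (H.preconnected t) (H.notMem_of_lt hp ht) hvt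
    (not_separates_trans (H.preconnected s) (H.flip.notMem_of_lt hp' hs) (mt Separates.symm hst)
      hsu)

theorem exists_node_or_edge [Finite S] (hv : p (inl (σ v)) = 0) (hu : p (inr (σ u)) = 0) :
    (∃ x, p (inl (σ x)) = 0 ∧ p (inr (σ x)) = 0) ∨ ∃ x y, G.Adj x y ∧
      p (inr (σ x)) = 0 ∧ p (inl (σ y)) = 0 ∧ 0 < p (inl (σ x)) ∧ 0 < p (inr (σ y)) := by
  obtain ⟨w, hw⟩ := (H.isTree.connected.preconnected v u).exists_isPath
  have eq_zero_of_pos : ∀ x ∈ w.support, 0 < p (inl (σ x)) → p (inr (σ x)) = 0 := fun x hx hl =>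
    le_antisymm (le_of_not_gt fun hr => H.not_separates_of_pos hp hv hu hl hr
      (separates_of_mem_support H.isTree.isAcyclic hw hx)) (hp.2 _)
  by_cases hul : p (inl (σ u)) = 0
  · exact Or.inl ⟨u, hul, hu⟩
  obtain ⟨e, he, hfst, hsnd⟩ := w.exists_boundary_dart {x | p (inl (σ x)) = 0} hv hul
  have hsnd' : 0 < p (inl (σ e.snd)) := (hp.2 _).lt_of_ne' hsnd
  rcases (hp.2 (inr (σ e.fst))).eq_or_lt' with h | h
  · exact Or.inl ⟨e.fst, hfst, h⟩
  · exact Or.inr ⟨e.snd, e.fst, e.adj.symm,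
      eq_zero_of_pos _ (w.dart_snd_mem_support_of_mem_darts he) hsnd', hfst, hsnd', h⟩

theorem tight_of_adj [Finite S] (h : G.Adj u v) (hv : p (inl (σ v)) = 0) (hu : p (inr (σ u)) = 0)
    (hul : 0 < p (inl (σ u))) (hvr : 0 < p (inr (σ v))) : Tight μ p (σ u) (σ v) := by
  have hp' := comp_swap_mem_nonnegPart_Q hp
  obtain ⟨t, hut, ht⟩ := exists_tight_right_lt hp.1 hul
  obtain ⟨s, hsv, hs⟩ := exists_tight_left_lt hp.1 hvr
  have hv_ut : Separates G v {u} (T t) := by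
    rcases separates_or_mem_of_adj H.isTree.isAcyclic (H.preconnected t) h with hsep | hsep | hmem
    · exact absurd hsep (H.not_separates_node_of_lt hp.1.1 hv ht)
    · exact hsep
    · exact absurd hmem.1 (H.notMem_of_lt hp ht)
  have hv_st : Separates G v (T s) (T t) := by
    by_contra hst
    exact not_separates_trans (H.preconnected s) (H.flip.notMem_of_lt hp' hs)
      (H.flip.not_separates_node_of_lt hp'.1.1 hu hs) hst hv_ut
  refine le_antisymm ?_ (hp.1.1 _ _)
  have hst := H.additive hv_st
  have hut' := H.eq_add_of_separates_node hv_ut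
  linarith [hp.1.1 s t]

theorem mem_of_mem_zeroSet (h : G.Adj u v) (huv : Tight μ p (σ u) (σ v))
    (hul : 0 < p (inl (σ u))) (hvr : 0 < p (inr (σ v))) (hs : s ∈ zeroSet p) :
    u ∈ T s ∧ v ∈ T s := by
  rcases separates_or_mem_of_adj H.isTree.isAcyclic (H.preconnected s) h with hsep | hsep | hmem
  · have hsv := H.flip.eq_add_of_separates_node hsep
    simp only [_root_.flip] at hsv
    linarith [hp.1.1 s (σ v), hs.1, H.nonneg s (σ u)]
  · have hus := H.eq_add_of_separates_node hsep
    linarith [hp.1.1 (σ u) s, hs.2, H.nonneg (σ v) s]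
  · exact hmem

/-! ### Points without a zero on one side are proper fats -/

theorem exists_node_eq_zero_of_tight [Finite S] {r : S} (hr : p (inl r) = 0) (hs : Tight μ p s r)
    (hpos : 0 < μ s r) : ∃ w, p (inl (σ w)) = 0 := by
  have hdisj : Disjoint (T s) (T r) := Set.disjoint_left.2 fun y hys hyr => by
    linarith [H.triangle s r y, H.right_eq_zero hys, H.left_eq_zero hyr]
  obtain ⟨w, hw, hsep⟩ := exists_mem_separates_of_disjoint H.isTree (H.connected s)
    (H.connected r) hdisj
  refine ⟨w, by_contra fun hne => ?_⟩
  obtain ⟨t, -, ht⟩ := exists_tight_right_lt hp.1 ((hp.2 _).lt_of_ne' hne)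
  have hsw : p (inl s) ≤ μ s (σ w) := by
    linarith [H.additive hsep, H.left_eq_zero hw, hp.2 (inr r)]
  have hst : ¬ Separates G w (T s) (T t) := H.not_separates_of_lt hp.1.1 (by linarith)
  have hrt : ¬ Separates G w (T r) (T t) :=
    H.not_separates_of_lt hp.1.1 (by linarith [H.nonneg r (σ w)])
  exact not_separates_trans (H.preconnected t) (H.notMem_of_lt hp ht) hst (mt Separates.symm hrt)
    hsep

theorem false_of_mutual [Finite S] (hpos : ∀ v, 0 < p (inl (σ v))) (h : G.Adj u v)
    (hu : ∀ t, p (inr t) < μ (σ u) t → ¬ Separates G u {v} (T t))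
    (hv : ∀ t, p (inr t) < μ (σ v) t → ¬ Separates G v {u} (T t))
    (hvu : μ (σ v) (σ u) = 0) : False := by
  obtain ⟨t, -, ht⟩ := exists_tight_right_lt hp.1 (hpos v)
  rcases separates_or_mem_of_adj H.isTree.isAcyclic (H.preconnected t) h with hsep | hsep | hmem
  · refine hu t ?_ hsep
    rwa [H.eq_add_of_separates_node hsep, hvu, zero_add] at ht
  · exact hv t ht hsep
  · exact H.notMem_of_lt hp ht hmem.2

theorem exists_node_forall_tight_eq_zero [Finite S] [Finite V] (hpos : ∀ v, 0 < p (inl (σ v))) :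
    ∃ u, ∀ s, Tight μ p s (σ u) → p (inl s) = 0 := by
  by_contra! hne
  have exists_neighbor : ∀ u, ∃ v, G.Adj u v ∧
      ∀ t, p (inr t) < μ (σ u) t → ¬ Separates G u {v} (T t) := by
    intro u
    obtain ⟨s, hsu, hs⟩ := hne u
    have hs' : 0 < p (inl s) := (hp.2 _).lt_of_ne' hs
    obtain ⟨y, hy⟩ := (H.connected s).nonempty
    have hus : u ∉ T s := fun hmem => by linarith [H.right_eq_zero hmem, hp.2 (inr (σ u))]
    obtain ⟨v, huv, -, hv⟩ :=
      exists_adj_not_separates H.isTree.connected (ne_of_mem_of_not_mem hy hus).symm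
    refine ⟨v, huv, fun t ht => not_separates_trans (H.preconnected s) hus
      (fun hsep => hv (hsep.mono_right (Set.singleton_subset_iff.2 hy)))
      (H.not_separates_of_lt hp.1.1 ?_)⟩
    linarith [hp.2 (inr (σ u))]
  choose n hadj hn using exists_neighbor
  obtain ⟨v, hv⟩ := exists_involutive_neighbor H.isTree hadj
  have hn' := hn (n v)
  rw [hv] at hn'
  rcases H.oneWay (hadj v) with h | h
  · exact H.false_of_mutual hp hpos (hadj v).symm hn' (hn v) h
  · exact H.false_of_mutual hp hpos (hadj v) (hn v) hn' h

theorem tight_left_closed_of_pos [Finite S] [Finite V] (hpos : ∀ v, 0 < p (inl (σ v))) :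
    (∀ s t, Tight μ p s t → t ∈ zeroSet p → s ∈ zeroSet p) ∧
      ∃ t ∉ zeroSet p, ∀ s, Tight μ p s t → s ∈ zeroSet p := by
  have eq_zero_of_tight : ∀ s r, p (inl r) = 0 → Tight μ p s r → μ s r = 0 := fun s r hr hsr =>
    le_antisymm (le_of_not_gt fun h => by
      obtain ⟨w, hw⟩ := H.exists_node_eq_zero_of_tight hp hr hsr h
      exact (hpos w).ne' hw) (H.nonneg s r)
  have mem_zeroSet : ∀ s, p (inl s) = 0 → s ∈ zeroSet p := fun s hs => by
    obtain ⟨r, hr⟩ := exists_tight_left hp.1 s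
    exact ⟨hs, le_antisymm (by linarith [eq_zero_of_tight r s hs hr, hp.2 (inl r)]) (hp.2 _)⟩
  obtain ⟨u, hu⟩ := H.exists_node_forall_tight_eq_zero hp hpos
  refine ⟨fun s t hst ht => mem_zeroSet s ?_, σ u, fun h => (hpos u).ne' h.1,
    fun s hs => mem_zeroSet s (hu s hs)⟩
  linarith [eq_zero_of_tight s t ht.1 hst, hp.2 (inl s), ht.2]

theorem isProperFat_of_pos [Finite S] [Finite V]
    (h : (∀ v, 0 < p (inl (σ v))) ∨ ∀ v, 0 < p (inr (σ v))) : IsProperFat μ p := by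
  rw [isProperFat_iff (zeroSet_mem_S0 H.nonneg hp.1.1) (mem_QX_zeroSet H.diag hp)]
  refine h.imp (H.tight_left_closed_of_pos hp) fun hpos => ?_
  obtain ⟨hclosed, t, ht, hts⟩ :=
    H.flip.tight_left_closed_of_pos (comp_swap_mem_nonnegPart_Q hp) hpos
  exact ⟨fun s t hst hs => (hclosed t s hst.comp_swap hs.symm).symm, t, mt And.symm ht,
    fun s hs => (hts s hs.comp_swap).symm⟩

end NonnegPart

theorem mem_nonnegPart_Qslim_iff [Finite S] [Finite V] :
    p ∈ nonnegPart (Qslim μ) ↔ p ∈ nonnegPart (Q μ) ∧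
      (∃ v, p (inl (σ v)) = 0) ∧ ∃ u, p (inr (σ u)) = 0 := by
  constructor
  · rintro ⟨⟨hpQ, hslim⟩, hp0⟩
    refine ⟨⟨hpQ, hp0⟩, ?_, ?_⟩ <;> by_contra! hne <;>
      refine hslim (H.isProperFat_of_pos ⟨hpQ, hp0⟩ ?_)
    · exact Or.inl fun v => (hp0 _).lt_of_ne' (hne v)
    · exact Or.inr fun u => (hp0 _).lt_of_ne' (hne u)
  · rintro ⟨hp, ⟨v, hv⟩, u, hu⟩
    exact ⟨⟨hp.1, not_isProperFat_of_eq_zero H.nonneg H.diag hp (H.pt_mem_P v) hv (H.pt_mem_P u)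
      hu⟩, hp.2⟩

/-! ### Nodes and edges -/

theorem pt_mem [Finite S] [Finite V] (v : V) : pt μ (σ v) ∈ nonnegPart (Qslim μ) := by
  refine H.mem_nonnegPart_Qslim_iff.2
    ⟨⟨mem_Q_of_tight (H.pt_mem_P v) (fun s => ⟨σ v, ?_⟩) fun t => ⟨σ v, ?_⟩, ?_⟩,
      ⟨v, H.node_self v⟩, v, H.node_self v⟩
  · simp [Tight, pt, H.node_self]
  · simp [Tight, pt, H.node_self]
  · rintro (s | s)
    exacts [H.nonneg _ _, H.nonneg _ _]

theorem exists_tight_of_segment (h : G.Adj u v) (hvu : μ (σ v) (σ u) = 0) (hcd : c + d = 1)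
    (s : S) : ∃ t, Tight μ (c • pt μ (σ u) + d • pt μ (σ v)) s t := by
  rcases H.eq_or_eq_of_adj h hvu s with hs | hs
  · refine ⟨σ v, ?_⟩
    simp only [Tight, Pi.add_apply, Pi.smul_apply, pt, Sum.elim_inl, Sum.elim_inr, smul_eq_mul,
      H.node_self]
    linear_combination (μ s (σ v)) * hcd - c * hs
  · refine ⟨σ u, ?_⟩
    simp only [Tight, Pi.add_apply, Pi.smul_apply, pt, Sum.elim_inl, Sum.elim_inr, smul_eq_mul,
      H.node_self, hvu]
    linear_combination (μ s (σ u)) * hcd + d * hs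

theorem segment_subset [Finite S] [Finite V] (h : G.Adj u v) (hvu : μ (σ v) (σ u) = 0) :
    segment ℝ (pt μ (σ u)) (pt μ (σ v)) ⊆ nonnegPart (Qslim μ) := by
  intro p hp
  have hpP := convex_P.segment_subset (H.pt_mem_P u) (H.pt_mem_P v) hp
  obtain ⟨c, d, hc, hd, hcd, rfl⟩ := hp
  refine H.mem_nonnegPart_Qslim_iff.2
    ⟨⟨mem_Q_of_tight hpP (H.exists_tight_of_segment h hvu hcd) fun t => ?_, ?_⟩,
      ⟨v, ?_⟩, u, ?_⟩
  · obtain ⟨s, hs⟩ := H.flip.exists_tight_of_segment h.symm hvu ((add_comm d c).trans hcd) t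
    exact ⟨s, by rw [Tight, add_comm, add_comm (c • _)]; exact hs⟩
  · rintro (s | s)
    · exact add_nonneg (mul_nonneg hc (H.nonneg _ _)) (mul_nonneg hd (H.nonneg _ _))
    · exact add_nonneg (mul_nonneg hc (H.nonneg _ _)) (mul_nonneg hd (H.nonneg _ _))
  · simp [pt, H.node_self, hvu]
  · simp [pt, H.node_self, hvu]

theorem smul_add_smul_le (h : G.Adj u v) (hvu : μ (σ v) (σ u) = 0) (hp : p ∈ P μ)
    (hu : p (inr (σ u)) = 0) (hcd : c + d = 1) (hc : p (inr (σ v)) = c * μ (σ u) (σ v)) (s : S) :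
    c * μ s (σ u) + d * μ s (σ v) ≤ p (inl s) := by
  rcases H.eq_or_eq_of_adj h hvu s with hs | hs
  · calc c * μ s (σ u) + d * μ s (σ v) = μ s (σ v) - p (inr (σ v)) := by
          rw [hc]
          linear_combination (μ s (σ v)) * hcd - c * hs
      _ ≤ p (inl s) := by linarith [hp s (σ v)]
  · calc c * μ s (σ u) + d * μ s (σ v) = μ s (σ u) := by
          linear_combination (μ s (σ u)) * hcd + d * hs
      _ ≤ p (inl s) := by linarith [hp s (σ u)]

theorem mem_segment_of_adj (h : G.Adj u v) (hp : p ∈ Q μ) (hv : p (inl (σ v)) = 0)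
    (hu : p (inr (σ u)) = 0) (huv : Tight μ p (σ u) (σ v)) (hul : 0 < p (inl (σ u)))
    (hvr : 0 < p (inr (σ v))) : p ∈ segment ℝ (pt μ (σ u)) (pt μ (σ v)) := by
  set D := μ (σ u) (σ v)
  have hpos : 0 < D := (add_pos hul hvr).trans_eq huv
  have hvu : μ (σ v) (σ u) = 0 :=
    le_antisymm (by simpa [hv, hu] using hp.1 (σ v) (σ u)) (H.nonneg _ _)
  have hcd : p (inr (σ v)) / D + p (inl (σ u)) / D = 1 := by
    rw [← add_div, add_comm, huv, div_self hpos.ne']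
  have hseg : (p (inr (σ v)) / D) • pt μ (σ u) + (p (inl (σ u)) / D) • pt μ (σ v) ∈
      segment ℝ (pt μ (σ u)) (pt μ (σ v)) :=
    ⟨_, _, (div_pos hvr hpos).le, (div_pos hul hpos).le, hcd, rfl⟩
  convert hseg
  refine Minimal.eq_of_ge hp (convex_P.segment_subset (H.pt_mem_P u) (H.pt_mem_P v) hseg) ?_
  rintro (s | s)
  · exact H.smul_add_smul_le h hvu hp.1 hu hcd (div_mul_cancel₀ _ hpos.ne').symm s
  · exact (add_comm _ _).trans_le (H.flip.smul_add_smul_le h.symm hvu (comp_swap_mem_P hp.1) hv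
      ((add_comm _ _).trans hcd) (div_mul_cancel₀ _ hpos.ne').symm s)

theorem eq_pt_or_mem_segment [Finite S] [Finite V] (hp : p ∈ nonnegPart (Qslim μ)) :
    (∃ v, p = pt μ (σ v)) ∨ ∃ u v, G.Adj u v ∧ 0 < μ (σ u) (σ v) ∧
      p ∈ segment ℝ (pt μ (σ u)) (pt μ (σ v)) ∧ ∀ s ∈ zeroSet p, u ∈ T s ∧ v ∈ T s := by
  obtain ⟨hp, ⟨v, hv⟩, u, hu⟩ := H.mem_nonnegPart_Qslim_iff.1 hp
  rcases H.exists_node_or_edge hp hv hu with ⟨x, hl, hr⟩ | ⟨x, y, h, hx, hy, hl, hr⟩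
  · exact Or.inl ⟨x, eq_pt_of_eq_zero hp.1 (H.pt_mem_P x) hl hr⟩
  · have hxy := H.tight_of_adj hp h hy hx hl hr
    exact Or.inr ⟨x, y, h, (add_pos hl hr).trans_eq hxy,
      H.mem_segment_of_adj h hp.1 hy hx hxy hl hr, fun s => H.mem_of_mem_zeroSet hp h hxy hl hr⟩

theorem exists_mem_pt_eq [Finite S] [Finite V] (hs : s ∈ zeroSet (pt μ (σ v))) :
    ∃ w ∈ T s, pt μ (σ v) = pt μ (σ w) := by
  by_cases hv : v ∈ T s
  · exact ⟨v, hv, rfl⟩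
  obtain ⟨w, hw, hsep⟩ := exists_mem_separates_of_disjoint H.isTree (H.connected (σ v))
    (H.connected s) (by rwa [H.node, Set.disjoint_singleton_left])
  refine ⟨w, hw, eq_pt_of_eq_zero (H.pt_mem v).1.1 (H.pt_mem_P w) ?_ ?_⟩
  · have := H.additive hsep.symm
    simp only [pt, zeroSet, Set.mem_ofPred_eq, Sum.elim_inl] at hs ⊢
    linarith [H.nonneg s (σ w), H.nonneg (σ w) (σ v)]
  · have := H.additive hsep
    simp only [pt, zeroSet, Set.mem_ofPred_eq, Sum.elim_inr] at hs ⊢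
    linarith [H.nonneg (σ v) (σ w), H.nonneg (σ w) s]

/-! ### The slimmed section -/

theorem eq_of_mem_QX (hp : p ∈ nonnegPart (Q μ)) (hq : q ∈ nonnegPart (Q μ)) (hpX : p ∈ QX μ X)
    (hqX : q ∈ QX μ X) (hx : σ x ∈ X) : p = q := by
  have eq_pt : ∀ {r}, r ∈ nonnegPart (Q μ) → r ∈ QX μ X → r = pt μ (σ x) := fun hr hrX => by
    rw [QX_unique hrX (mem_QX_zeroSet H.diag hr)] at hx
    exact eq_pt_of_eq_zero hr.1 (H.pt_mem_P x) hx.1 hx.2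
  rw [eq_pt hp hpX, eq_pt hq hqX]

theorem shift_eq_zero [Finite S] [Finite V] (hp : p ∈ nonnegPart (Qslim μ))
    (hq : q ∈ nonnegPart (Qslim μ)) (h : ∀ v, p (inl (σ v)) - q (inl (σ v)) = c) : c = 0 := by
  obtain ⟨-, ⟨v, hv⟩, -⟩ := H.mem_nonnegPart_Qslim_iff.1 hp
  obtain ⟨-, ⟨w, hw⟩, -⟩ := H.mem_nonnegPart_Qslim_iff.1 hq
  exact le_antisymm (by linarith [h v, hq.2 (inl (σ v))]) (by linarith [h w, hp.2 (inl (σ w))])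

theorem eq_of_slimRel [Finite S] [Finite V] (hp : p ∈ nonnegPart (Qslim μ))
    (hq : q ∈ nonnegPart (Qslim μ)) (h : SlimRel μ p q) : p = q := by
  have hp' : p ∈ nonnegPart (Q μ) := ⟨hp.1.1, hp.2⟩
  have hq' : q ∈ nonnegPart (Q μ) := ⟨hq.1.1, hq.2⟩
  rcases h with ⟨c, h⟩ | ⟨X, -, ⟨hpX, -⟩, ⟨hqX, -⟩, c, d, h⟩
  · obtain rfl := H.shift_eq_zero hp hq fun v => by
      simpa [shiftVec] using congrFun h (inl (σ v))
    rwa [zero_smul, sub_eq_zero] at h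
  by_cases hx : ∃ x, σ x ∈ X
  · obtain ⟨x, hx⟩ := hx
    exact H.eq_of_mem_QX hp' hq' hpX hqX hx
  obtain rfl := H.shift_eq_zero hp hq fun v => by
    simpa [shiftVec, not_exists.1 hx v] using congrFun h (inl (σ v))
  have hpX' := QX_unique hpX (mem_QX_zeroSet H.diag hp')
  have hqX' := QX_unique hqX (mem_QX_zeroSet H.diag hq')
  have eq_of_mem : ∀ s ∈ X, p (inl s) = q (inl s) ∧ p (inr s) = q (inr s) := fun s hs => by
    obtain ⟨hpl, hpr⟩ := hpX' ▸ hs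
    obtain ⟨hql, hqr⟩ := hqX' ▸ hs
    exact ⟨hpl.trans hql.symm, hpr.trans hqr.symm⟩
  rw [zero_smul, zero_add] at h
  funext u
  rw [← sub_eq_zero]
  rcases u with s | s <;> by_cases hs : s ∈ X
  · exact sub_eq_zero.2 (eq_of_mem s hs).1
  · simpa [shiftVec, hs] using congrFun h (inl s)
  · exact sub_eq_zero.2 (eq_of_mem s hs).2
  · simpa [shiftVec, hs] using congrFun h (inr s)

theorem exists_slimRel [Finite S] [Nonempty S] (hp : p ∈ Qslim μ) :
    ∃ q ∈ nonnegPart (Qslim μ), SlimRel μ q p := by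
  obtain ⟨s₀, hs₀⟩ := Finite.exists_min fun s => p (inl s)
  have hq := add_smul_shiftVec_univ_mem_Q hp.1 (-p (inl s₀))
  have hsub : p + (-p (inl s₀)) • shiftVec Set.univ - p = (-p (inl s₀)) • shiftVec Set.univ :=
    add_sub_cancel_left _ _
  refine ⟨_, ⟨⟨hq, (isProperFat_congr hq hp.1 (K_eq_of_sub hsub)).not.2 hp.2⟩, ?_⟩,
    Or.inl ⟨_, hsub⟩⟩
  rintro (s | s) <;> simp only [shiftVec, Pi.add_apply, Pi.smul_apply, Sum.elim_inl,
    Sum.elim_inr, Set.indicator_univ, smul_eq_mul]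
  · linarith [hs₀ s]
  · linarith [hp.1.1 s₀ s, H.nonneg s₀ s]

theorem isSlimmedSection [Finite S] [Finite V] : IsSlimmedSection μ (nonnegPart (Qslim μ)) := by
  have : Nonempty S := H.isTree.connected.nonempty.map σ
  refine ⟨subset_rfl, ⟨fun p hp => hp.1, fun _ _ => trivial, ?_, ?_⟩, ?_, ?_⟩
  · exact fun p hp q hq h => Subtype.ext (H.eq_of_slimRel hp hq (Quotient.exact h))
  · rintro ⟨p⟩ -
    obtain ⟨q, hq, hqp⟩ := H.exists_slimRel p.2
    exact ⟨⟨q, hq.1⟩, hq, Quotient.sound hqp⟩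
  · rintro ⟨p, hp, q, hq, h⟩
    obtain ⟨-, ⟨v, hv⟩, u, hu⟩ := H.mem_nonnegPart_Qslim_iff.1 hq
    rcases h with h | h
    · exact (h (σ v)).not_ge (hv.trans_le (hp.2 _))
    · exact (h (σ u)).not_ge (hu.trans_le (hp.2 _))
  · rintro X - ⟨p, ⟨hp, hpX, -⟩, q, ⟨hq, hqX, -⟩, hne, h⟩
    have hX : ∀ x, σ x ∉ X := fun x hx =>
      hne (H.eq_of_mem_QX ⟨hp.1.1, hp.2⟩ ⟨hq.1.1, hq.2⟩ hpX.1 hqX.1 hx)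
    obtain ⟨-, ⟨v, hv⟩, u, hu⟩ := H.mem_nonnegPart_Qslim_iff.1 hq
    rcases h with h | h
    · exact (h (σ v) (hX v)).not_ge (hv.trans_le (hp.2 _))
    · exact (h (σ u) (hX u)).not_ge (hu.trans_le (hp.2 _))

theorem not_isFat_of_mem_region [Finite S] (hne : ∃ s t, μ s t ≠ 0)
    (hv : ∀ t, μ (σ v) t ≤ μ s t) (hu : ∀ t, μ t (σ u) ≤ μ t s) (hp : p ∈ region (Q μ) s) :
    ¬ IsFat μ p := by
  set q : CRSpace S := p + (-p (inl s)) • shiftVec Set.univ with hq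
  have hqQ : q ∈ Q μ := add_smul_shiftVec_univ_mem_Q hp.1 _
  have hql : q (inl s) = 0 := by simp [hq, shiftVec]
  have hqr : q (inr s) = 0 := by
    simp only [hq, shiftVec, Pi.add_apply, Pi.smul_apply, Sum.elim_inr, Set.indicator_univ,
      smul_eq_mul]
    linarith [hp.2]
  have hq0 : q ∈ nonnegPart (Q μ) := by
    refine ⟨hqQ, ?_⟩
    rintro (t | t)
    · linarith [hqQ.1 t s, H.nonneg t s]
    · linarith [hqQ.1 s t, H.nonneg s t]
  have hvq : q (inl (σ v)) = 0 := by
    obtain ⟨t, ht⟩ := exists_tight_right hqQ (σ v)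
    exact le_antisymm (by linarith [hv t, hqQ.1 s t]) (hq0.2 _)
  have huq : q (inr (σ u)) = 0 := by
    obtain ⟨t, ht⟩ := exists_tight_left hqQ (σ u)
    exact le_antisymm (by linarith [hu t, hqQ.1 t s]) (hq0.2 _)
  rw [isFat_congr hp.1 hqQ (K_eq_of_sub (add_sub_cancel_left _ _)).symm]
  exact not_isFat_of_eq_zero H.nonneg H.diag hne hq0 (H.pt_mem_P v) hvq (H.pt_mem_P u) huq
    ⟨hql, hqr⟩

end IsSubtreeDistance

/-! ### Lengths in oriented trees -/

theorem subgraph_adj_of_isAcyclic {V : Type*} {G : SimpleGraph V} {H : G.Subgraph} {u v : V}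
    (hG : G.IsAcyclic) (hH : H.Connected) (h : G.Adj u v) (hu : u ∈ H.verts) (hv : v ∈ H.verts) :
    H.Adj u v := by
  obtain ⟨w, hw⟩ := (Subgraph.connected_iff_forall_exists_walk_subgraph H).1 hH |>.2 hu hv
  have hmem := isBridge_iff_forall_walk_mem_edges.1 (isAcyclic_iff_forall_adj_isBridge.1 hG h) w
  exact hw.2 (Walk.adj_toSubgraph_iff_mem_edges.2 hmem)

namespace OrientedTree

variable {V : Type*} (Γ : OrientedTree V) {α : V → V → ℝ} {u v x : V}

theorem eq_path {w : Γ.graph.Walk u v} (hw : w.IsPath) : w = Γ.path u v :=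
  (Γ.isTree.existsUnique_path u v).choose_spec.2 w hw

theorem path_eq_append (hx : x ∈ (Γ.path u v).support) :
    Γ.path u v = (Γ.path u x).append (Γ.path x v) := by
  classical
  have hpath : (Γ.path u v).IsPath := (Γ.isTree.existsUnique_path u v).choose_spec.1
  conv_lhs => rw [← (Γ.path u v).take_spec hx]
  rw [Γ.eq_path (hpath.takeUntil hx), Γ.eq_path (hpath.dropUntil hx)]

theorem path_self (v : V) : Γ.path v v = Walk.nil :=
  (Γ.eq_path Walk.IsPath.nil).symm

theorem path_adj (h : Γ.graph.Adj u v) : Γ.path u v = Walk.cons h Walk.nil :=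
  (Γ.eq_path (by simp [Walk.cons_isPath_iff, h.ne])).symm

open Classical in
/-- The total length of the edges that a walk traverses in their forward direction, counted with
multiplicity. On the path from `u` to `v` it is `Γ.dist α u v`. -/
noncomputable def walkLength (α : V → V → ℝ) (w : Γ.graph.Walk u v) : ℝ :=
  (w.darts.map fun d => if Γ.Adj d.fst d.snd then α d.fst d.snd else 0).sum

theorem dist_eq_walkLength (u v : V) : Γ.dist α u v = Γ.walkLength α (Γ.path u v) := rfl

theorem walkLength_append (w : Γ.graph.Walk u v) (w' : Γ.graph.Walk v x) :
    Γ.walkLength α (w.append w') = Γ.walkLength α w + Γ.walkLength α w' := by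
  simp [walkLength]

theorem dist_self (u : V) : Γ.dist α u u = 0 := by
  simp [dist_eq_walkLength, path_self, walkLength]

theorem dist_eq_add (hx : x ∈ (Γ.path u v).support) :
    Γ.dist α u v = Γ.dist α u x + Γ.dist α x v := by
  rw [dist_eq_walkLength, Γ.path_eq_append hx, walkLength_append]
  rfl

open Classical in
theorem dist_adj (h : Γ.graph.Adj u v) : Γ.dist α u v = if Γ.Adj u v then α u v else 0 := by
  simp [dist_eq_walkLength, Γ.path_adj h, walkLength]

theorem graph_adj_of_adj (h : Γ.Adj u v) : Γ.graph.Adj u v :=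
  ⟨fun e => Γ.asymm _ _ h (e ▸ h), Or.inl h⟩

theorem dist_eq_zero_of_adj (h : Γ.Adj u v) : Γ.dist α v u = 0 := by
  rw [Γ.dist_adj (Γ.graph_adj_of_adj h).symm, if_neg (Γ.asymm _ _ h)]

theorem adj_of_dist_pos (h : Γ.graph.Adj u v) (hd : 0 < Γ.dist α u v) : Γ.Adj u v := by
  by_contra hn
  rw [Γ.dist_adj h, if_neg hn] at hd
  exact hd.false

section LengthNonneg

variable (hα : ∀ u v, Γ.Adj u v → 0 ≤ α u v)
include hα

theorem dist_le_walkLength (w : Γ.graph.Walk u v) : Γ.dist α u v ≤ Γ.walkLength α w := by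
  classical
  rw [dist_eq_walkLength, ← Γ.eq_path w.bypass_isPath]
  refine (w.darts_bypass_sublist_darts.map _).sum_le_sum fun x hx => ?_
  obtain ⟨d, -, rfl⟩ := List.mem_map.1 hx
  split_ifs with h
  exacts [hα _ _ h, le_rfl]

theorem dist_nonneg (u v : V) : 0 ≤ Γ.dist α u v := by
  refine List.sum_nonneg fun x hx => ?_
  obtain ⟨d, -, rfl⟩ := List.mem_map.1 hx
  split_ifs with h
  exacts [hα _ _ h, le_rfl]

theorem dist_triangle (u v x : V) : Γ.dist α u v ≤ Γ.dist α u x + Γ.dist α x v :=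
  (Γ.dist_le_walkLength hα ((Γ.path u x).append (Γ.path x v))).trans_eq (Γ.walkLength_append _ _)

theorem dist_eq_zero_of_forward (w : Γ.graph.Walk u v)
    (hw : ∀ d ∈ w.darts, Γ.Adj d.fst d.snd) : Γ.dist α v u = 0 := by
  induction w with
  | nil => exact Γ.dist_self _
  | @cons a b c h w ih =>
    simp only [Walk.darts_cons, List.mem_cons, forall_eq_or_imp] at hw
    refine le_antisymm ((Γ.dist_triangle hα c a b).trans_eq ?_) (Γ.dist_nonneg hα _ _)
    rw [ih hw.2, Γ.dist_eq_zero_of_adj hw.1, add_zero]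

end LengthNonneg

end OrientedTree

/-! ### Oriented-tree realizations -/

namespace IsRealization

variable {S V : Type*} {μ : S → S → ℝ} {Γ : OrientedTree V} {α : V → V → ℝ}
  {F : S → Γ.graph.Subgraph} {s t : S} {u v x : V} (hF : IsRealization μ Γ α F)

include hF

theorem connected (s : S) : (F s).Connected :=
  Subgraph.connected_iff'.2 (hF.subtree s).connected

theorem le_dist (hu : u ∈ (F s).verts) (hv : v ∈ (F t).verts) : μ s t ≤ Γ.dist α u v := by
  rw [hF.dist_eq]
  refine csInf_le ⟨0, ?_⟩ ⟨u, hu, v, hv, rfl⟩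
  rintro _ ⟨x, -, y, -, rfl⟩
  exact Γ.dist_nonneg hF.length_nonneg x y

theorem exists_dist_eq [Finite V] (s t : S) :
    ∃ u ∈ (F s).verts, ∃ v ∈ (F t).verts, μ s t = Γ.dist α u v := by
  obtain ⟨u, hu⟩ := (hF.connected s).nonempty
  obtain ⟨v, hv⟩ := (hF.connected t).nonempty
  have hfin : {x | ∃ u ∈ (F s).verts, ∃ v ∈ (F t).verts, x = Γ.dist α u v}.Finite := by
    refine (Set.finite_range fun z : V × V => Γ.dist α z.1 z.2).subset ?_
    rintro _ ⟨x, -, y, -, rfl⟩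
    exact ⟨(x, y), rfl⟩
  have hne : {x | ∃ u ∈ (F s).verts, ∃ v ∈ (F t).verts, x = Γ.dist α u v}.Nonempty :=
    ⟨_, u, hu, v, hv, rfl⟩
  rw [hF.dist_eq]
  exact hne.csInf_mem hfin

theorem nonneg [Finite V] (s t : S) : 0 ≤ μ s t := by
  obtain ⟨u, -, v, -, h⟩ := hF.exists_dist_eq s t
  exact h ▸ Γ.dist_nonneg hF.length_nonneg u v

theorem pt_congr (h : (F s).verts = (F t).verts) : pt μ s = pt μ t := by
  funext x
  rcases x with x | x <;> simp only [pt, Sum.elim_inl, Sum.elim_inr, hF.dist_eq, h]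

variable {σ : V → S} (hσ : ∀ v, IsNode (F (σ v)) v)
include hσ

theorem le_dist_node_right (hx : x ∈ (F s).verts) : μ s (σ v) ≤ Γ.dist α x v :=
  hF.le_dist hx ((hσ v).symm ▸ rfl)

theorem le_dist_node_left (hx : x ∈ (F s).verts) : μ (σ v) s ≤ Γ.dist α v x :=
  hF.le_dist ((hσ v).symm ▸ rfl) hx

variable [Finite V]

theorem exists_dist_eq_node_right (s : S) (v : V) :
    ∃ x ∈ (F s).verts, μ s (σ v) = Γ.dist α x v := by
  obtain ⟨x, hx, y, hy, h⟩ := hF.exists_dist_eq s (σ v)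
  rw [hσ] at hy
  exact ⟨x, hx, Set.mem_singleton_iff.1 hy ▸ h⟩

theorem exists_dist_eq_node_left (s : S) (v : V) :
    ∃ x ∈ (F s).verts, μ (σ v) s = Γ.dist α v x := by
  obtain ⟨y, hy, x, hx, h⟩ := hF.exists_dist_eq (σ v) s
  rw [hσ] at hy
  exact ⟨x, hx, Set.mem_singleton_iff.1 hy ▸ h⟩

theorem dist_node (u v : V) : μ (σ u) (σ v) = Γ.dist α u v := by
  obtain ⟨x, hx, h⟩ := hF.exists_dist_eq_node_right hσ (σ u) v
  rw [hσ] at hx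
  exact Set.mem_singleton_iff.1 hx ▸ h

theorem triangle (s t : S) (v : V) : μ s t ≤ μ s (σ v) + μ (σ v) t := by
  obtain ⟨x, hx, h⟩ := hF.exists_dist_eq_node_right hσ s v
  obtain ⟨y, hy, h'⟩ := hF.exists_dist_eq_node_left hσ t v
  rw [h, h']
  exact (hF.le_dist hx hy).trans (Γ.dist_triangle hF.length_nonneg _ _ _)

theorem isSubtreeDistance : IsSubtreeDistance Γ.graph (fun s => (F s).verts) σ μ where
  isTree := Γ.isTree
  connected s := (hF.connected s).induce_verts
  node := hσ
  nonneg := hF.nonneg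
  right_eq_zero hv :=
    le_antisymm ((hF.le_dist_node_right hσ hv).trans_eq (Γ.dist_self _)) (hF.nonneg _ _)
  left_eq_zero hv :=
    le_antisymm ((hF.le_dist_node_left hσ hv).trans_eq (Γ.dist_self _)) (hF.nonneg _ _)
  triangle := hF.triangle hσ
  additive {v s t} hsep := by
    refine le_antisymm (hF.triangle hσ s t v) ?_
    obtain ⟨x, hx, y, hy, h⟩ := hF.exists_dist_eq s t
    rw [h, Γ.dist_eq_add (hsep x hx y hy _)]
    exact add_le_add (hF.le_dist_node_right hσ hx) (hF.le_dist_node_left hσ hy)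
  oneWay h := by
    rw [hF.dist_node hσ, hF.dist_node hσ]
    exact h.2.symm.imp Γ.dist_eq_zero_of_adj Γ.dist_eq_zero_of_adj

theorem exists_ends (h : (∃ v, IsNode (F s) v) ∨ IsDirectedPath (F s)) :
    ∃ u v, (∀ t, μ (σ v) t ≤ μ s t) ∧ ∀ t, μ t (σ u) ≤ μ t s := by
  classical
  have hα := hF.length_nonneg
  obtain ⟨u, v, hv, hu⟩ : ∃ u v, (∀ x ∈ (F s).verts, Γ.dist α v x = 0) ∧
      ∀ x ∈ (F s).verts, Γ.dist α x u = 0 := by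
    rcases h with ⟨v, hv⟩ | ⟨u, v, w, -, hw, hs⟩
    · rw [hv]
      exact ⟨v, v, fun x hx => hx ▸ Γ.dist_self x, fun x hx => hx ▸ Γ.dist_self x⟩
    · simp only [hs, Walk.mem_verts_toSubgraph]
      exact ⟨u, v,
        fun x hx => Γ.dist_eq_zero_of_forward hα (w.dropUntil x hx)
          fun d hd => hw d (w.darts_dropUntil_subset_darts hx hd),
        fun x hx => Γ.dist_eq_zero_of_forward hα (w.takeUntil x hx)
          fun d hd => hw d (w.darts_takeUntil_subset_darts hx hd)⟩
  refine ⟨u, v, fun t => ?_, fun t => ?_⟩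
  · obtain ⟨x, hx, y, hy, h⟩ := hF.exists_dist_eq s t
    calc μ (σ v) t ≤ Γ.dist α v y := hF.le_dist_node_left hσ hy
      _ ≤ Γ.dist α v x + Γ.dist α x y := Γ.dist_triangle hα _ _ _
      _ = μ s t := by rw [hv x hx, zero_add, h]
  · obtain ⟨y, hy, x, hx, h⟩ := hF.exists_dist_eq t s
    calc μ t (σ u) ≤ Γ.dist α y u := hF.le_dist_node_right hσ hy
      _ ≤ Γ.dist α y x + Γ.dist α x u := Γ.dist_triangle hα _ _ _
      _ = μ t s := by rw [hu x hx, add_zero, h]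

variable [Finite S]

theorem segmentUnion_subset (H : Γ.graph.Subgraph) :
    segmentUnion μ Γ F H ⊆ nonnegPart (Qslim μ) := by
  have hμ := hF.isSubtreeDistance hσ
  rintro p (⟨s, v, hs, -, rfl⟩ | ⟨s, t, u, v, hs, ht, huv, -, hp⟩)
  · rw [hF.pt_congr (hs.trans (hσ v).symm)]
    exact hμ.pt_mem v
  · rw [hF.pt_congr (hs.trans (hσ u).symm), hF.pt_congr (ht.trans (hσ v).symm)] at hp
    refine hμ.segment_subset (Γ.graph_adj_of_adj huv) ?_ hp
    rw [hF.dist_node hσ, Γ.dist_eq_zero_of_adj huv]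

theorem nonnegPart_Qslim_eq : nonnegPart (Qslim μ) = segmentUnion μ Γ F ⊤ := by
  refine Set.Subset.antisymm (fun p hp => ?_) (hF.segmentUnion_subset hσ ⊤)
  rcases (hF.isSubtreeDistance hσ).eq_pt_or_mem_segment hp with ⟨v, hv⟩ | ⟨u, v, h, hpos, hseg, -⟩
  · exact Or.inl ⟨σ v, v, hσ v, trivial, hv⟩
  · rw [hF.dist_node hσ] at hpos
    exact Or.inr ⟨σ u, σ v, u, v, hσ u, hσ v, Γ.adj_of_dist_pos h hpos, h, hseg⟩

theorem region_nonnegPart_Qslim_subset (s : S) :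
    region (nonnegPart (Qslim μ)) s ⊆ segmentUnion μ Γ F (F s) := by
  have hμ := hF.isSubtreeDistance hσ
  rintro p ⟨hp, hs⟩
  have hs' : s ∈ zeroSet p := (add_eq_zero_iff_of_nonneg (hp.2 _) (hp.2 _)).1 hs
  rcases hμ.eq_pt_or_mem_segment hp with ⟨v, rfl⟩ | ⟨u, v, h, hpos, hseg, hmem⟩
  · obtain ⟨w, hw, hvw⟩ := hμ.exists_mem_pt_eq hs'
    exact Or.inl ⟨σ w, w, hσ w, hw, hvw⟩
  · rw [hF.dist_node hσ] at hpos
    obtain ⟨hu, hv⟩ := hmem s hs'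
    exact Or.inr ⟨σ u, σ v, u, v, hσ u, hσ v, Γ.adj_of_dist_pos h hpos,
      subgraph_adj_of_isAcyclic Γ.isTree.isAcyclic (hF.connected s) h hu hv, hseg⟩

theorem region_nonnegPart_Qslim_eq (s : S) :
    region (nonnegPart (Qslim μ)) s = segmentUnion μ Γ F (F s) := by
  have hμ := hF.isSubtreeDistance hσ
  refine Set.Subset.antisymm (hF.region_nonnegPart_Qslim_subset hσ s) fun p hp =>
    ⟨hF.segmentUnion_subset hσ _ hp, ?_⟩
  rcases hp with ⟨t, v, ht, hv, rfl⟩ | ⟨t, t', u, v, ht, ht', -, huv, hp⟩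
  · rw [hF.pt_congr (ht.trans (hσ v).symm)]
    simp [pt, hμ.right_eq_zero hv, hμ.left_eq_zero hv]
  · rw [hF.pt_congr (ht.trans (hσ u).symm), hF.pt_congr (ht'.trans (hσ v).symm)] at hp
    obtain ⟨c, d, -, -, -, rfl⟩ := hp
    simp [pt, hμ.right_eq_zero huv.fst_mem, hμ.left_eq_zero huv.fst_mem,
      hμ.right_eq_zero huv.snd_mem, hμ.left_eq_zero huv.snd_mem]

end IsRealization

end DirectedMultiflow

open DirectedMultiflow in
theorem mainTheorem7 {S V : Type*} [Finite S] (μ : S → S → ℝ) (hμ : IsDirectedDistance μ)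
    (Γ : OrientedTree V) (α : V → V → ℝ) (F : S → Γ.graph.Subgraph)
    (hF : IsRealization μ Γ α F) (hall : ∀ v : V, ∃ s, IsNode (F s) v) :
    nonnegPart (Qslim μ) = segmentUnion μ Γ F ⊤ ∧
    (∀ s, region (nonnegPart (Qslim μ)) s = segmentUnion μ Γ F (F s)) ∧
    IsSlimmedSection μ (nonnegPart (Qslim μ)) ∧
    ((∃ s t, μ s t ≠ 0) → ∀ s, ((∃ v, IsNode (F s) v) ∨ IsDirectedPath (F s)) →
      ∀ p ∈ region (Q μ) s, ¬ IsFat μ p) := by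
  choose σ hσ using hall
  have : Finite V := Finite.of_injective σ fun u v h =>
    Set.singleton_injective ((hσ u).symm.trans ((congrArg (fun s => (F s).verts) h).trans (hσ v)))
  have hT := hF.isSubtreeDistance hσ
  refine ⟨hF.nonnegPart_Qslim_eq hσ, hF.region_nonnegPart_Qslim_eq hσ, hT.isSlimmedSection,
    fun hne s hs p hp => ?_⟩
  obtain ⟨u, v, hv, hu⟩ := hF.exists_ends hσ hs
  exact hT.not_isFat_of_mem_region hne hv hu hp
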